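/- Let $D\ge 2$ be an integer. A GEM of dimension $D$ and size $N$ is a tuple $(\alpha_1,\dots,\alpha_{D+1})$ of perfect matchings of $[N]=\{1,\dots,N\}$ (permutations of $[N]$ whose orbits all have length $2$): it encodes the complex obtained from $N$ labelled $D$-simplices, each with vertices coloured $1,\dots,D+1$, by gluing, for all $k$ and $i$, the hyperfaces opposite to the $k$th vertices of the simplices $i$ and $\alpha_k(i)$. Its graph has vertex set $[N]$ and an edge joining $i$ to $\alpha_k(i)$ for all $i,k$; the GEM is connected if its graph is. An orientable GEM is here a GEM whose graph is bipartite, taken together with an ordered partition $[N]=A\sqcup B$ such that each $\alpha_k$ exchanges $A$ and $B$ (so there are $\binom{2n}{n}(n!)^{D+1}=(2n)!\,(n!)^{D-1}$ orientable GEMs of dimension $D$ and size $2n$). For $d\ge1$, a $d$-multipermutation of size $k$ is a $d$-tuple $(\sigma_1,\dots,\sigma_d)$ of permutations of $[k]$; it is indecomposable if there is no $j$ with $1\le j<k$ such that $\sigma_i([j])=[j]$ for all $i$. Let $\mathfrak{imp}_k(d)$ be the number of indecomposable $d$-multipermutations of size $k$, and write $(n)_k=n(n-1)\cdots(n-k+1)$.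 Let $P_n$ be the probability that a uniformly random orientable GEM of dimension $D$ and size $2n$ is connected. Then $$P_n\approx 1-\sum_{k\ge1}\frac{\mathfrak{imp}_k(D-1)}{\big((n)_k\big)^{D-1}},$$ in the following sense: with $f_0(n)=1$ and $f_k(n)=-\mathfrak{imp}_k(D-1)/\big((n)_k\big)^{D-1}$ for $k\ge1$, one has, as $n\to\infty$, for every $r\ge0$, $$P_n=\sum_{k=0}^{r}f_k(n)+O\big(f_{r+1}(n)\big)\qquad\text{and, for every }k\ge0,\qquad f_{k+1}(n)=o\big(f_k(n)\big).$$ -/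

import Mathlib

open Filter Asymptotics

/-- `a n ≈ ∑_{k ≥ m} f k n`: for every `r ≥ m` one has
`a n = ∑_{k=m}^{r} f k n + O(f (r+1) n)` as `n → ∞`, and each term is negligible with
respect to the preceding one. -/
def HasAsymptoticExpansion (a : ℕ → ℝ) (m : ℕ) (f : ℕ → ℕ → ℝ) : Prop :=
  (∀ r, m ≤ r →
    (fun n => a n - ∑ k ∈ Finset.Icc m r, f k n) =O[atTop] (fun n => f (r + 1) n)) ∧
  (∀ k, m ≤ k → (fun n => f (k + 1) n) =o[atTop] (fun n => f k n))

/-- A perfect matching of `[N]`, seen as a permutation all of whose orbits have length two. -/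
def IsPerfectMatching {N : ℕ} (α : Equiv.Perm (Fin N)) : Prop :=
  ∀ i, α (α i) = i ∧ α i ≠ i

/-- A (labelled) GEM of dimension `D` and size `N`: for each of the `D + 1` colours, a perfect
matching of the `N` simplices.  The hyperface opposite to vertex `k` of simplex `i` is glued to
the hyperface opposite to vertex `k` of simplex `glue k i`. -/
@[ext]
structure GEM (D N : ℕ) where
  glue : Fin (D + 1) → Equiv.Perm (Fin N)
  matching : ∀ k, IsPerfectMatching (glue k)

/-- The graph of a GEM: vertices are the simplices, two of them being adjacent when they are
glued along some hyperface (colours and multiplicities of edges are forgotten). -/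
def GEM.graph {D N : ℕ} (g : GEM D N) : SimpleGraph (Fin N) where
  Adj i j := ∃ k, g.glue k i = j
  symm := ⟨by
    rintro i j ⟨k, rfl⟩
    exact ⟨k, (g.matching k i).1⟩⟩
  loopless := ⟨by
    rintro i ⟨k, hk⟩
    exact (g.matching k i).2 hk⟩

/-- An orientable GEM, together with its partition of the simplices into an ordered pair of
classes `A` and `B = Aᶜ` such that every gluing joins a simplex of `A` to one of `B`.
(The two classes then automatically have the same size.) -/
@[ext]
structure OrientableGEM (D N : ℕ) extends GEM D N where
  A : Finset (Fin N)
  bipartite : ∀ k i, i ∈ A ↔ glue k i ∉ A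

instance (D N : ℕ) : Finite (OrientableGEM D N) :=
  Finite.of_injective
    (fun g : OrientableGEM D N => (g.glue, g.A)) (by
      intro g h hgh
      have h1 : g.glue = h.glue := congrArg Prod.fst hgh
      have h2 : g.A = h.A := congrArg Prod.snd hgh
      exact OrientableGEM.ext h1 h2)

/-- An orientable GEM is connected when its graph is. -/
def OrientableGEM.IsConnected {D N : ℕ} (g : OrientableGEM D N) : Prop :=
  g.toGEM.graph.Connected

/-- The probability that a uniformly random orientable GEM of dimension `D` and size `N` is
connected. -/
noncomputable def probConnectedOrientableGEM (D N : ℕ) : ℝ :=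
  (Nat.card {g : OrientableGEM D N // g.IsConnected} : ℝ) / (Nat.card (OrientableGEM D N) : ℝ)

/-- A `d`-multipermutation of size `n` is a `d`-tuple of permutations of `[n]`. -/
abbrev Multipermutation (d n : ℕ) : Type := Fin d → Equiv.Perm (Fin n)

/-- A multipermutation is indecomposable if no proper non-empty initial segment `[k]` of `[n]`
is mapped onto itself by all of its members. -/
def Multipermutation.IsIndecomposable {d n : ℕ} (σ : Multipermutation d n) : Prop :=
  ¬ ∃ k, 1 ≤ k ∧ k < n ∧
    ∀ i, (σ i) '' {j : Fin n | (j : ℕ) < k} = {j : Fin n | (j : ℕ) < k}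

/-- The number of indecomposable `d`-multipermutations of size `n`. -/
noncomputable def numIndecomposable (d n : ℕ) : ℕ :=
  Nat.card {σ : Multipermutation d n // σ.IsIndecomposable}

/-! Put d = D - 1 ≥ 1, f_n = (n!)^d and F(z) = ∑ f_n z^n. There are (2n)! f_n gluings on 2n vertices
and none on an odd number, so with z = x² the exponential generating function of gluings is F, and
that of connected ones is C = log F up to its constant term. Hence P_n = c_n / f_n for n ≥ 1, where
c_n = [z^n] C. Cutting a multipermutation after its first stable segment gives G := 1/F = 1 - I,
where I counts the non-empty indecomposable ones. The claim becomes c_n ≈ ∑ g_k f_{n-k}, a case of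
Bender's theorem: f grows so fast that convolutions are dominated by their two ends, and the
coefficients are those of log'(F) = 1/F.

The proof (`log_expansion`) splits the convolution z C' = z F' · G. The middle is negligible by
`sum_factorial_mul_factorial_le`. The end where f has the large index gives ∑ (n - k) g_k f_{n-k}.
At the other end g_{n-k} is itself expanded, with the coefficients of -1/F²
(`expansionRemainder_isBigO`); since z F' · (-G²) = z G', this cancels the unwanted -k g_k f_{n-k}.
Dividing by n concludes. -/

/-! ### Bipartite gluings and their components -/

/-- An orientable gluing on an arbitrary vertex type: `D + 1` involutions reversing a
two-colouring of the vertices. -/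
@[ext]
structure BipartiteGluing (D : ℕ) (V : Type*) where
  glue : Fin (D + 1) → V → V
  color : V → Bool
  glue_glue : ∀ k v, glue k (glue k v) = v
  color_glue : ∀ k v, color (glue k v) = !color v

namespace BipartiteGluing

variable {D : ℕ} {V W : Type*}

instance [Finite V] : Finite (BipartiteGluing D V) :=
  Finite.of_injective (fun p : BipartiteGluing D V => (p.glue, p.color)) (by
    intro p q h
    exact BipartiteGluing.ext (congrArg Prod.fst h) (congrArg Prod.snd h))

/-- Two vertices are linked when a sequence of gluings leads from the first to the second. -/
def Reach (p : BipartiteGluing D V) : V → V → Prop :=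
  Relation.ReflTransGen fun x y => ∃ k, p.glue k x = y

/-- The set of vertices linked to a given one. -/
def component (p : BipartiteGluing D V) (v : V) : Set V := {w | p.Reach v w}

/-- Any two vertices are linked. -/
def Connected (p : BipartiteGluing D V) : Prop := ∀ v w, p.Reach v w

theorem reach_symm (p : BipartiteGluing D V) {v w : V} (h : p.Reach v w) : p.Reach w v := by
  have : Std.Symm fun x y => ∃ k, p.glue k x = y := ⟨by
    rintro x y ⟨k, rfl⟩
    exact ⟨k, p.glue_glue k x⟩⟩
  exact Relation.ReflTransGen.stdSymm.symm _ _ h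

theorem mem_component_self (p : BipartiteGluing D V) (v : V) : v ∈ p.component v :=
  Relation.ReflTransGen.refl

theorem glue_mem_component (p : BipartiteGluing D V) {v w : V} (k : Fin (D + 1))
    (h : w ∈ p.component v) : p.glue k w ∈ p.component v :=
  Relation.ReflTransGen.tail h ⟨k, rfl⟩

theorem component_subset (p : BipartiteGluing D V) {v : V} {S : Set V} (hv : v ∈ S)
    (hS : ∀ k, ∀ x ∈ S, p.glue k x ∈ S) : p.component v ⊆ S := by
  intro w hw
  induction hw with
  | refl => exact hv
  | tail _ h ih =>
    obtain ⟨k, rfl⟩ := h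
    exact hS k _ ih

theorem connected_of_reach (p : BipartiteGluing D V) (v : V) (h : ∀ w, p.Reach v w) :
    p.Connected :=
  fun x y => (p.reach_symm (h x)).trans (h y)

/-- The gluing induced on an invariant set of vertices. -/
@[simps]
def restrict (p : BipartiteGluing D V) (S : Set V) (hS : ∀ k, ∀ x ∈ S, p.glue k x ∈ S) :
    BipartiteGluing D S where
  glue k x := ⟨p.glue k x, hS k x x.2⟩
  color x := p.color x
  glue_glue k x := Subtype.ext (p.glue_glue k x)
  color_glue k x := p.color_glue k x

theorem glue_mem_compl (p : BipartiteGluing D V) {S : Set V}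
    (hS : ∀ k, ∀ x ∈ S, p.glue k x ∈ S) (k : Fin (D + 1)) (x : V) (hx : x ∈ Sᶜ) :
    p.glue k x ∈ Sᶜ := by
  intro h
  apply hx
  simpa [p.glue_glue] using hS k _ h

open Classical in
/-- The disjoint union of gluings on a set of vertices and on its complement. -/
@[simps]
noncomputable def union {S : Set V} (q : BipartiteGluing D S)
    (r : BipartiteGluing D (Sᶜ : Set V)) : BipartiteGluing D V where
  glue k x := if h : x ∈ S then q.glue k ⟨x, h⟩ else r.glue k ⟨x, h⟩
  color x := if h : x ∈ S then q.color ⟨x, h⟩ else r.color ⟨x, h⟩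
  glue_glue k x := by
    by_cases h : x ∈ S
    · simp [h, q.glue_glue]
    · have := (r.glue k ⟨x, h⟩).2
      rw [Set.mem_compl_iff] at this
      simp [h, this, r.glue_glue]
  color_glue k x := by
    by_cases h : x ∈ S
    · simp [h, q.color_glue]
    · have := (r.glue k ⟨x, h⟩).2
      rw [Set.mem_compl_iff] at this
      simp [h, this, r.color_glue]

theorem union_glue_mem {S : Set V} (q : BipartiteGluing D S)
    (r : BipartiteGluing D (Sᶜ : Set V)) (k : Fin (D + 1)) (x : V) (hx : x ∈ S) :
    (q.union r).glue k x ∈ S := by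
  simp [hx]

theorem coe_reach {p : BipartiteGluing D V} {S : Set V} {q : BipartiteGluing D S}
    (h : ∀ k (x : S), p.glue k x = q.glue k x) {x y : S} (hxy : q.Reach x y) :
    p.Reach x y := by
  refine Relation.ReflTransGen.lift (fun a : S => (a : V)) ?_ _ _ hxy
  rintro a b ⟨k, rfl⟩
  exact ⟨k, h k a⟩

theorem restrict_connected (p : BipartiteGluing D V) {S : Set V}
    (hS : ∀ k, ∀ x ∈ S, p.glue k x ∈ S) (v : S) (hv : p.component v = S) :
    (p.restrict S hS).Connected := by
  refine connected_of_reach _ v ?_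
  -- The points reachable without leaving `S` form a set that contains `v` and is closed under the
  -- gluings.
  have key : p.component v ⊆ {w | ∃ h : w ∈ S, (p.restrict S hS).Reach v ⟨w, h⟩} := by
    refine p.component_subset ⟨v.2, Relation.ReflTransGen.refl⟩ ?_
    rintro k x ⟨h, hx⟩
    exact ⟨hS k x h, Relation.ReflTransGen.tail hx ⟨k, rfl⟩⟩
  intro w
  rw [hv] at key
  exact (key w.2).2

/-- Gluings for which `S` is the component of a given vertex are pairs formed of a connected
gluing on `S` and of a gluing on the complement of `S`. -/
noncomputable def componentEquiv (D : ℕ) {S : Set V} (v : S) :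
    {p : BipartiteGluing D V // p.component v = S} ≃
      {q : BipartiteGluing D S // q.Connected} × BipartiteGluing D (Sᶜ : Set V) where
  toFun p :=
    have hS : ∀ k, ∀ x ∈ S, p.1.glue k x ∈ S := fun k x hx => by
      have := p.1.glue_mem_component (v := v) (w := x) k (by rw [p.2]; exact hx)
      rwa [p.2] at this
    (⟨p.1.restrict S hS, p.1.restrict_connected hS v p.2⟩,
      p.1.restrict Sᶜ (p.1.glue_mem_compl hS))
  invFun q := ⟨q.1.1.union q.2, by
    refine Set.Subset.antisymm ?_ ?_
    · exact component_subset _ v.2 (union_glue_mem _ _)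
    · intro w hw
      exact coe_reach (q := q.1.1) (fun k x => by simp) (q.1.2 v ⟨w, hw⟩)⟩
  left_inv p := by
    apply Subtype.ext
    apply BipartiteGluing.ext
    · funext k x
      by_cases h : x ∈ S <;> simp [h]
    · funext x
      by_cases h : x ∈ S <;> simp [h]
  right_inv q := by
    obtain ⟨⟨q, hq⟩, r⟩ := q
    refine Prod.ext (Subtype.ext (BipartiteGluing.ext ?_ ?_)) (BipartiteGluing.ext ?_ ?_)
    · funext k x
      apply Subtype.ext
      simp
    · funext x
      simp
    · funext k x
      have := x.2
      rw [Set.mem_compl_iff] at this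
      apply Subtype.ext
      simp [this]
    · funext x
      have := x.2
      rw [Set.mem_compl_iff] at this
      simp [this]

/-- Transport of a gluing along a bijection of the vertices. -/
@[simps]
def map (e : V ≃ W) (p : BipartiteGluing D V) : BipartiteGluing D W where
  glue k x := e (p.glue k (e.symm x))
  color x := p.color (e.symm x)
  glue_glue k x := by simp [p.glue_glue]
  color_glue k x := by simp [p.color_glue]

/-- Transport of gluings along a bijection of the vertices, as an equivalence. -/
def mapEquiv (D : ℕ) (e : V ≃ W) : BipartiteGluing D V ≃ BipartiteGluing D W where
  toFun := map e
  invFun := map e.symm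
  left_inv p := by ext <;> simp
  right_inv p := by ext <;> simp

theorem Connected.map (e : V ≃ W) {p : BipartiteGluing D V} (h : p.Connected) :
    (p.map e).Connected := by
  intro x y
  have := Relation.ReflTransGen.lift (p := fun x y => ∃ k, (p.map e).glue k x = y) e
    (by rintro a b ⟨k, rfl⟩; exact ⟨k, by simp⟩) _ _ (h (e.symm x) (e.symm y))
  simpa [Function.onFun, Reach] using this

theorem connected_map_iff (e : V ≃ W) (p : BipartiteGluing D V) :
    (p.map e).Connected ↔ p.Connected :=
  ⟨fun h => (show map e.symm (map e p) = p from (mapEquiv D e).left_inv p) ▸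
    Connected.map e.symm h, Connected.map e⟩

/-- The number of gluings on `n` vertices. -/
noncomputable def count (D n : ℕ) : ℕ := Nat.card (BipartiteGluing D (Fin n))

/-- The number of connected gluings on `n` vertices. -/
noncomputable def connCount (D n : ℕ) : ℕ :=
  Nat.card {p : BipartiteGluing D (Fin n) // p.Connected}

theorem card_eq_count [Finite V] : Nat.card (BipartiteGluing D V) = count D (Nat.card V) :=
  Nat.card_congr (mapEquiv D (Finite.equivFin V))

theorem card_connected_eq_connCount [Finite V] :
    Nat.card {p : BipartiteGluing D V // p.Connected} = connCount D (Nat.card V) :=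
  Nat.card_congr ((mapEquiv D (Finite.equivFin V)).subtypeEquiv
    fun p => (connected_map_iff (Finite.equivFin V) p).symm)

theorem card_component_eq [Fintype V] [DecidableEq V] (v : V) (S : Finset V) :
    Nat.card {p : BipartiteGluing D V // p.component v = S} =
      if v ∈ S then connCount D S.card * count D (Fintype.card V - S.card) else 0 := by
  split_ifs with h
  · rw [Nat.card_congr (componentEquiv D (S := (S : Set V)) ⟨v, h⟩), Nat.card_prod,
      card_connected_eq_connCount, card_eq_count]
    congr 2
    · simp
    · rw [← Finset.coe_compl]
      rw [Nat.card_coe_set_eq, Set.ncard_coe_finset, Finset.card_compl]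
  · rw [Nat.card_eq_zero]
    left
    constructor
    rintro ⟨p, hp⟩
    apply h
    have := p.mem_component_self v
    rw [hp] at this
    exact this

theorem count_eq_sum_component (n : ℕ) (v : Fin n) :
    count D n = ∑ S : Finset (Fin n),
      if v ∈ S then connCount D S.card * count D (n - S.card) else 0 := by
  classical
  let φ : BipartiteGluing D (Fin n) → Finset (Fin n) := fun p => (p.component v).toFinset
  rw [count, ← Nat.card_congr (Equiv.sigmaFiberEquiv φ), Nat.card_sigma]
  refine Finset.sum_congr rfl fun S _ => ?_
  have := card_component_eq (D := D) v S
  rw [Fintype.card_fin] at this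
  rw [← this]
  refine Nat.card_congr (Equiv.subtypeEquivRight fun p => ?_)
  simp only [φ]
  constructor
  · rintro rfl
    simp
  · intro h
    ext x
    simp [h]

/-- Recurrence obtained by pointing a vertex and isolating its component. -/
theorem mul_count_eq (n : ℕ) :
    n * count D n = ∑ m ∈ Finset.range (n + 1),
      n.choose m * (m * (connCount D m * count D (n - m))) := by
  have h : n * count D n = ∑ v : Fin n, ∑ S : Finset (Fin n),
      if v ∈ S then connCount D S.card * count D (n - S.card) else 0 := by
    rw [Finset.sum_congr rfl fun v _ => (count_eq_sum_component (D := D) n v).symm]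
    simp
  -- After the exchange, each `S` is counted once per vertex, whence the factor `m`.
  rw [h, Finset.sum_comm]
  have h2 := Finset.sum_powerset_apply_card
    (fun m => m * (connCount D m * count D (n - m))) (x := (Finset.univ : Finset (Fin n)))
  simp only [Finset.powerset_univ, Finset.card_univ, Fintype.card_fin, smul_eq_mul] at h2
  rw [← h2]
  refine Finset.sum_congr rfl fun S _ => ?_
  rw [← Finset.sum_filter]
  simp

/-! ### Counting gluings -/

/-- A gluing amounts to a two-colouring and a family of bijections between its colour classes. -/
def sigmaEquiv (D : ℕ) (V : Type*) : BipartiteGluing D V ≃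
    Σ c : V → Bool, Fin (D + 1) → ({v // c v = true} ≃ {v // ¬ c v = true}) where
  toFun p := ⟨p.color, fun k =>
    { toFun := fun x => ⟨p.glue k x, by simp [p.color_glue, x.2]⟩
      invFun := fun x => ⟨p.glue k x, by simpa [p.color_glue] using x.2⟩
      left_inv := fun x => Subtype.ext (p.glue_glue k x)
      right_inv := fun x => Subtype.ext (p.glue_glue k x) }⟩
  invFun q :=
    { glue := fun k x => if h : q.1 x = true then q.2 k ⟨x, h⟩ else (q.2 k).symm ⟨x, h⟩
      color := q.1
      glue_glue := fun k x => by
        by_cases h : q.1 x = true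
        · have := (q.2 k ⟨x, h⟩).2
          simp [h, this]
        · have := ((q.2 k).symm ⟨x, h⟩).2
          rw [dif_neg h, dif_pos this]
          simp
      color_glue := fun k x => by
        by_cases h : q.1 x = true
        · have := (q.2 k ⟨x, h⟩).2
          simp only [h, dite_true]
          simpa using this
        · have := ((q.2 k).symm ⟨x, h⟩).2
          simp only [h]
          simpa [h] using this }
  left_inv p := by
    refine BipartiteGluing.ext ?_ rfl
    funext k x
    by_cases h : p.color x = true
    · simp [h]
    · simp [h]
  right_inv q := by
    obtain ⟨c, q⟩ := q
    refine Sigma.ext rfl (heq_of_eq ?_)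
    funext k
    ext x
    exact dif_pos x.2

theorem card_equiv_compl (n : ℕ) (S : Finset (Fin n)) :
    Nat.card ({v // v ∈ S} ≃ {v // ¬ v ∈ S}) =
      if 2 * S.card = n then S.card.factorial else 0 := by
  have h1 : Fintype.card {v // v ∈ S} = S.card := by simp
  have h2 : Fintype.card {v // ¬ v ∈ S} = n - S.card := by
    rw [Fintype.card_subtype_compl]; simp
  have h3 : S.card ≤ n := by simpa using S.card_le_univ
  split_ifs with h
  · have e : {v // v ∈ S} ≃ {v // ¬ v ∈ S} := Fintype.equivOfCardEq (by rw [h1, h2]; omega)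
    rw [Nat.card_eq_fintype_card, Fintype.card_equiv e, h1]
  · rw [Nat.card_eq_zero]
    left
    constructor
    intro e
    have := Fintype.card_congr e
    omega

theorem count_eq (n : ℕ) :
    count D n = ∑ m ∈ Finset.range (n + 1),
      n.choose m * (if 2 * m = n then m.factorial else 0) ^ (D + 1) := by
  rw [count, Nat.card_congr (sigmaEquiv D (Fin n)), Nat.card_sigma]
  have h2 := Finset.sum_powerset_apply_card
    (fun m => (if 2 * m = n then m.factorial else 0) ^ (D + 1)) (x := (Finset.univ : Finset (Fin n)))
  simp only [Finset.powerset_univ, Finset.card_univ, Fintype.card_fin, smul_eq_mul] at h2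
  rw [← h2]
  refine Fintype.sum_equiv
    (Equiv.ofBijective (fun c : Fin n → Bool => Finset.univ.filter fun v => c v = true) ?_) _ _ ?_
  · constructor
    · intro c c' h
      funext v
      have := congrArg (v ∈ ·) h
      simp only [Finset.mem_filter, Finset.mem_univ, true_and] at this
      exact Bool.eq_iff_iff.2 (by simpa using this)
    · intro S
      exact ⟨fun v => decide (v ∈ S), by ext; simp⟩
  · intro c
    rw [Nat.card_pi]
    simp only [← card_equiv_compl]
    rw [Finset.prod_const, Finset.card_univ, Fintype.card_fin]
    congr 1
    have h (v : Fin n) : c v = true ↔ v ∈ Finset.univ.filter fun v => c v = true := by simp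
    exact Nat.card_congr (Equiv.equivCongr (Equiv.subtypeEquivRight h)
      (Equiv.subtypeEquivRight fun v => (h v).not))

theorem count_two_mul (n : ℕ) :
    count D (2 * n) = (2 * n).choose n * n.factorial ^ (D + 1) := by
  rw [count_eq, Finset.sum_eq_single n]
  · simp
  · intro m _ hm
    rw [if_neg (by omega)]
    simp
  · intro h
    simp at h
    omega

theorem count_of_odd {n : ℕ} (hn : Odd n) : count D n = 0 := by
  rw [count_eq]
  refine Finset.sum_eq_zero fun m _ => ?_
  rw [if_neg (by obtain ⟨k, rfl⟩ := hn; omega)]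
  simp

end BipartiteGluing

/-! ### From GEMs to gluings -/

/-- Orientable GEMs of size `N` are the gluings on `N` vertices. -/
def OrientableGEM.equivBipartiteGluing (D N : ℕ) :
    OrientableGEM D N ≃ BipartiteGluing D (Fin N) where
  toFun g :=
    { glue := fun k => g.glue k
      color := fun v => decide (v ∈ g.A)
      glue_glue := fun k v => (g.matching k v).1
      color_glue := fun k v => by
        have := g.bipartite k v
        by_cases h : v ∈ g.A <;> simp_all }
  invFun p :=
    { glue := fun k => ⟨p.glue k, p.glue k, p.glue_glue k, p.glue_glue k⟩
      matching := fun k v => ⟨p.glue_glue k v, fun h => by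
        have := p.color_glue k v
        simp only [Equiv.coe_fn_mk] at h
        rw [h] at this
        simp at this⟩
      A := Finset.univ.filter fun v => p.color v = true
      bipartite := fun k v => by simp [p.color_glue] }
  left_inv g := by
    ext <;> simp
  right_inv p := by
    ext <;> simp

/-- `N ≠ 0` is essential: `SimpleGraph.Connected` requires a vertex, whereas the relation on gluings
holds vacuously on the empty type. -/
theorem OrientableGEM.isConnected_iff {D N : ℕ} [NeZero N] (g : OrientableGEM D N) :
    g.IsConnected ↔ (equivBipartiteGluing D N g).Connected := by
  rw [OrientableGEM.IsConnected, SimpleGraph.connected_iff]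
  have : Nonempty (Fin N) := ⟨0⟩
  simp only [this, and_true]
  refine forall₂_congr fun v w => ?_
  rw [SimpleGraph.reachable_iff_reflTransGen]
  rfl

theorem probConnectedOrientableGEM_eq (D N : ℕ) [NeZero N] :
    probConnectedOrientableGEM D N =
      (BipartiteGluing.connCount D N : ℝ) / BipartiteGluing.count D N := by
  rw [probConnectedOrientableGEM, BipartiteGluing.connCount, BipartiteGluing.count,
    Nat.card_congr (OrientableGEM.equivBipartiteGluing D N),
    Nat.card_congr ((OrientableGEM.equivBipartiteGluing D N).subtypeEquiv
      fun g => g.isConnected_iff)]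

/-! ### Multipermutations and their first block -/

namespace Multipermutation

variable {d n k m : ℕ}

/-- All the members of `σ` stabilise the initial segment `[j]`. -/
def Stabilizes (σ : Multipermutation d n) (j : ℕ) : Prop :=
  ∀ i, ∀ x : Fin n, (x : ℕ) < j → (σ i x : ℕ) < j

/-- An injective map sending a finite segment into itself sends it onto itself, so inclusion
suffices. -/
theorem isIndecomposable_iff (σ : Multipermutation d n) :
    σ.IsIndecomposable ↔ ∀ j, 1 ≤ j → j < n → ¬ σ.Stabilizes j := by
  have key : ∀ j i, (σ i) '' {x : Fin n | (x : ℕ) < j} = {x : Fin n | (x : ℕ) < j} ↔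
      ∀ x : Fin n, (x : ℕ) < j → (σ i x : ℕ) < j := by
    intro j i
    constructor
    · intro h x hx
      have : σ i x ∈ (σ i) '' {x : Fin n | (x : ℕ) < j} := ⟨x, hx, rfl⟩
      rw [h] at this
      exact this
    · intro h
      refine Set.eq_of_subset_of_ncard_le ?_ ?_
      · rintro _ ⟨x, hx, rfl⟩
        exact h x hx
      · rw [Set.ncard_image_of_injective _ (σ i).injective]
  simp only [IsIndecomposable, key, Stabilizes]
  push Not
  rfl

/-- `k` is the least positive size of a stable initial segment. -/
def IsFirstBlock (σ : Multipermutation d n) (k : ℕ) : Prop :=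
  σ.Stabilizes k ∧ ∀ j, 1 ≤ j → j < k → ¬ σ.Stabilizes j

/-- Juxtaposition of two multipermutations. -/
def append (σ : Multipermutation d k) (τ : Multipermutation d m) : Multipermutation d (k + m) :=
  fun i => finSumFinEquiv.permCongr (Equiv.sumCongr (σ i) (τ i))

@[simp]
theorem append_castAdd (σ : Multipermutation d k) (τ : Multipermutation d m) (i : Fin d)
    (x : Fin k) : σ.append τ i (Fin.castAdd m x) = Fin.castAdd m (σ i x) := by
  simp [append, Equiv.permCongr_apply]

theorem append_stabilizes_iff (σ : Multipermutation d k) (τ : Multipermutation d m) {j : ℕ}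
    (hj : j ≤ k) : (σ.append τ).Stabilizes j ↔ σ.Stabilizes j := by
  constructor
  · intro h i x hx
    simpa using h i (Fin.castAdd m x) hx
  · intro h i x hx
    have : x = Fin.castAdd m ⟨x, hx.trans_le hj⟩ := rfl
    rw [this, append_castAdd]
    exact h i _ hx

theorem stabilizes_self (σ : Multipermutation d n) : σ.Stabilizes n :=
  fun i x _ => (σ i x).2

theorem append_isFirstBlock_iff (σ : Multipermutation d k) (τ : Multipermutation d m) :
    (σ.append τ).IsFirstBlock k ↔ σ.IsIndecomposable := by
  rw [isIndecomposable_iff, IsFirstBlock, append_stabilizes_iff σ τ le_rfl]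
  simp only [stabilizes_self, true_and]
  refine forall_congr' fun j => forall₂_congr fun _ h => ?_
  rw [append_stabilizes_iff σ τ h.le]

theorem append_injective {σ σ' : Multipermutation d k} {τ τ' : Multipermutation d m}
    (h : σ.append τ = σ'.append τ') : σ = σ' ∧ τ = τ' := by
  have key : ∀ i, (σ i, τ i) = (σ' i, τ' i) := fun i =>
    Equiv.Perm.sumCongrHom_injective (finSumFinEquiv.permCongr.injective (congrFun h i))
  exact ⟨funext fun i => congrArg Prod.fst (key i), funext fun i => congrArg Prod.snd (key i)⟩

/-- A permutation of a finite sum type that preserves the left summand also preserves the right one.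
-/
theorem exists_eq_append {σ : Multipermutation d (k + m)} (h : σ.Stabilizes k) :
    ∃ (σ₁ : Multipermutation d k) (σ₂ : Multipermutation d m), σ = σ₁.append σ₂ := by
  have key : ∀ i, ∃ q : Equiv.Perm (Fin k) × Equiv.Perm (Fin m),
      Equiv.Perm.sumCongrHom _ _ q = finSumFinEquiv.symm.permCongr (σ i) := by
    intro i
    refine Equiv.Perm.mem_sumCongrHom_range_of_perm_mapsTo_inl ?_
    rintro _ ⟨x, rfl⟩
    refine ⟨⟨σ i (Fin.castAdd m x), h i _ x.2⟩, ?_⟩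
    rw [Equiv.permCongr_apply, Equiv.eq_symm_apply, Equiv.symm_symm, finSumFinEquiv_apply_left,
      finSumFinEquiv_apply_left]
    rfl
  choose q hq using key
  refine ⟨fun i => (q i).1, fun i => (q i).2, funext fun i => ?_⟩
  have : finSumFinEquiv.permCongr (Equiv.Perm.sumCongrHom _ _ (q i)) = σ i := by
    rw [hq i]
    ext
    simp [Equiv.permCongr_apply]
  exact this.symm

theorem card_eq (d n : ℕ) : Nat.card (Multipermutation d n) = n.factorial ^ d := by
  simp [Multipermutation, Nat.card_eq_fintype_card, Fintype.card_perm]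

theorem card_isFirstBlock (h : k + m = n) :
    Nat.card {σ : Multipermutation d n // σ.IsFirstBlock k} =
      numIndecomposable d k * m.factorial ^ d := by
  subst h
  rw [← card_eq, numIndecomposable, ← Nat.card_prod]
  refine (Nat.card_congr (Equiv.ofBijective
    (fun q : {σ : Multipermutation d k // σ.IsIndecomposable} × Multipermutation d m =>
      (⟨append q.1.1 q.2, (append_isFirstBlock_iff _ _).2 q.1.2⟩ :
        {σ : Multipermutation d (k + m) // σ.IsFirstBlock k})) ⟨?_, ?_⟩)).symm
  · rintro ⟨⟨σ, hσ⟩, τ⟩ ⟨⟨σ', hσ'⟩, τ'⟩ h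
    obtain ⟨rfl, rfl⟩ := append_injective (congrArg Subtype.val h)
    rfl
  · rintro ⟨σ, hσ⟩
    obtain ⟨σ₁, σ₂, rfl⟩ := exists_eq_append hσ.1
    exact ⟨⟨⟨σ₁, (append_isFirstBlock_iff _ _).1 hσ⟩, σ₂⟩, rfl⟩

/-- The whole segment is always stable, so a least positive stable size exists; the index is shifted
by one to keep it positive. -/
theorem existsUnique_isFirstBlock (σ : Multipermutation d (n + 1)) :
    ∃! j : Fin (n + 1), σ.IsFirstBlock (j + 1) := by
  classical
  have hex : ∃ j, σ.Stabilizes (j + 1) := ⟨n, σ.stabilizes_self⟩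
  have hle : Nat.find hex ≤ n := Nat.find_min' hex σ.stabilizes_self
  have hmin : ∀ a b : Fin (n + 1), σ.IsFirstBlock (a + 1) → σ.IsFirstBlock (b + 1) →
      (a : ℕ) ≤ b := by
    intro a b ha hb
    by_contra! hab
    exact ha.2 (b + 1) (by omega) (by omega) hb.1
  have hfirst : σ.IsFirstBlock (Nat.find hex + 1) := by
    refine ⟨Nat.find_spec hex, fun j h1 h2 => ?_⟩
    obtain ⟨i, rfl⟩ := Nat.exists_eq_add_of_le' h1
    exact Nat.find_min hex (by omega)
  refine ⟨⟨Nat.find hex, by omega⟩, hfirst, fun b hb => Fin.ext ?_⟩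
  exact le_antisymm (hmin _ _ hb hfirst) (hmin ⟨Nat.find hex, by omega⟩ b hfirst hb)

/-- Decomposition of a multipermutation along its first block. -/
theorem factorial_pow_eq_sum (d n : ℕ) :
    (n + 1).factorial ^ d =
      ∑ j ∈ Finset.range (n + 1), numIndecomposable d (j + 1) * (n - j).factorial ^ d := by
  classical
  choose φ hφ using fun σ : Multipermutation d (n + 1) => existsUnique_isFirstBlock σ
  rw [← card_eq, ← Nat.card_congr (Equiv.sigmaFiberEquiv φ), Nat.card_sigma, Finset.sum_range]
  refine Finset.sum_congr rfl fun j _ => ?_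
  rw [← card_isFirstBlock (show (j : ℕ) + 1 + (n - j) = n + 1 by omega)]
  refine Nat.card_congr (Equiv.subtypeEquivRight fun σ => ⟨?_, fun h => ?_⟩)
  · rintro rfl
    exact (hφ σ).1
  · exact ((hφ σ).2 j h).symm

end Multipermutation

theorem numIndecomposable_le (d n : ℕ) : numIndecomposable d n ≤ n.factorial ^ d := by
  rw [← Multipermutation.card_eq]
  exact Finite.card_subtype_le _

/-- The reversal sends the first point to the last, so it stabilises no proper segment. Positivity
makes every term of the expansion a genuine error scale. -/
theorem numIndecomposable_pos {d : ℕ} (hd : 0 < d) (n : ℕ) : 0 < numIndecomposable d n := by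
  have : Nonempty {σ : Multipermutation d n // σ.IsIndecomposable} := by
    refine ⟨fun _ => Fin.revPerm, (Multipermutation.isIndecomposable_iff _).2 ?_⟩
    intro j h1 h2 h
    have := h ⟨0, hd⟩ ⟨0, by omega⟩ h1
    simp [Fin.val_rev] at this
    omega
  exact Nat.card_pos

/-! ### Convolutions of factorials are dominated by their ends -/

/-- The sequence `n ↦ (n!) ^ d`. -/
noncomputable def factorialPow (d n : ℕ) : ℝ := (n.factorial : ℝ) ^ d

theorem factorialPow_pos (d n : ℕ) : 0 < factorialPow d n :=
  pow_pos (by exact_mod_cast n.factorial_pos) d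

@[simp]
theorem factorialPow_zero (d : ℕ) : factorialPow d 0 = 1 := by simp [factorialPow]

/-- Products of factorials with fixed sum decrease towards the centre. With k = r + a and n = 2r + a
+ b, induction on a compares the new factors r + a + 1 ≤ r + b + a + 1. -/
theorem factorial_mul_factorial_le {n r k : ℕ} (hr : r ≤ k) (hk : k + r ≤ n) :
    k.factorial * (n - k).factorial ≤ r.factorial * (n - r).factorial := by
  obtain ⟨a, rfl⟩ := Nat.exists_eq_add_of_le hr
  obtain ⟨b, rfl⟩ := Nat.exists_eq_add_of_le hk
  have h1 : r + a + r + b - (r + a) = r + b := by omega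
  have h2 : r + a + r + b - r = r + b + a := by omega
  rw [h1, h2]
  clear h1 h2 hr hk
  induction a with
  | zero => rfl
  | succ a ih =>
    rw [← add_assoc, ← add_assoc, Nat.factorial_succ, Nat.factorial_succ (r + b + a)]
    calc (r + a + 1) * (r + a).factorial * (r + b).factorial
        = (r + a + 1) * ((r + a).factorial * (r + b).factorial) := by ring
      _ ≤ (r + b + a + 1) * (r.factorial * (r + b + a).factorial) :=
          Nat.mul_le_mul (by omega) ih
      _ = _ := by ring

/-- The two extreme terms give 2 r! (n-r)!. The others number at most n - r, each at most (r+1)!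
(n-r-1)!. -/
theorem sum_factorial_mul_factorial_le {n r : ℕ} (hn : 2 * r + 1 ≤ n) :
    ∑ k ∈ Finset.Ico r (n + 1 - r), k.factorial * (n - k).factorial ≤
      (2 * r.factorial + (r + 1).factorial) * (n - r).factorial := by
  rw [Finset.sum_eq_sum_Ico_succ_bot (by omega), show n + 1 - r = (n - r) + 1 by omega,
    Finset.sum_Ico_succ_top (by omega)]
  have h1 : ∑ k ∈ Finset.Ico (r + 1) (n - r), k.factorial * (n - k).factorial ≤
      (r + 1).factorial * (n - r).factorial := by
    calc _ ≤ ∑ k ∈ Finset.Ico (r + 1) (n - r), (r + 1).factorial * (n - (r + 1)).factorial := by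
          refine Finset.sum_le_sum fun k hk => ?_
          rw [Finset.mem_Ico] at hk
          exact factorial_mul_factorial_le hk.1 (by omega)
      _ = (n - r - (r + 1)) * ((r + 1).factorial * (n - (r + 1)).factorial) := by simp
      _ ≤ (n - r) * ((r + 1).factorial * (n - (r + 1)).factorial) :=
          Nat.mul_le_mul_right _ (by omega)
      _ = (r + 1).factorial * (n - r).factorial := by
          obtain ⟨m, rfl⟩ := Nat.exists_eq_add_of_le' (show r + 1 ≤ n by omega)
          rw [show m + (r + 1) - r = m + 1 by omega, Nat.add_sub_cancel, Nat.factorial_succ m]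
          ring
  have h2 : n - (n - r) = r := by omega
  rw [h2]
  linarith

theorem sum_factorialPow_mul_le {d : ℕ} (hd : 0 < d) {n r : ℕ} (hn : 2 * r + 1 ≤ n) :
    ∑ k ∈ Finset.Ico r (n + 1 - r), factorialPow d k * factorialPow d (n - k) ≤
      ((2 * r.factorial + (r + 1).factorial : ℕ) : ℝ) ^ d * factorialPow d (n - r) := by
  have h : ∑ k ∈ Finset.Ico r (n + 1 - r), (k.factorial * (n - k).factorial) ^ d ≤
      ((2 * r.factorial + (r + 1).factorial) * (n - r).factorial) ^ d := by
    -- For d ≥ 1, a sum of d-th powers of naturals is at most the d-th power of the sum.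
    refine le_trans ?_ (Nat.pow_le_pow_left (sum_factorial_mul_factorial_le hn) d)
    obtain ⟨e, rfl⟩ := Nat.exists_eq_succ_of_ne_zero hd.ne'
    rw [pow_succ, Finset.mul_sum]
    refine Finset.sum_le_sum fun k hk => ?_
    rw [pow_succ]
    refine Nat.mul_le_mul_right _ (Nat.pow_le_pow_left ?_ e)
    exact Finset.single_le_sum (f := fun k => k.factorial * (n - k).factorial)
      (fun _ _ => Nat.zero_le _) hk
  simp only [factorialPow, ← mul_pow]
  exact_mod_cast h

/-- The weight serves twice: w = 1 for inverting the series, and w k = k with M = n for its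
logarithmic derivative. -/
theorem norm_sum_mul_le {d : ℕ} (hd : 0 < d) {g : ℕ → ℝ} (hg : ∀ n, |g n| ≤ factorialPow d n)
    (w : ℕ → ℝ) {n r : ℕ} (hn : 2 * r + 1 ≤ n) {M : ℝ} (hw : ∀ k ≤ n, |w k| ≤ M) :
    |∑ k ∈ Finset.Ico r (n + 1 - r), w k * factorialPow d k * g (n - k)| ≤
      ((2 * r.factorial + (r + 1).factorial : ℕ) : ℝ) ^ d * (M * factorialPow d (n - r)) := by
  have hM : 0 ≤ M := (abs_nonneg _).trans (hw 0 (Nat.zero_le _))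
  calc _ ≤ ∑ k ∈ Finset.Ico r (n + 1 - r), |w k * factorialPow d k * g (n - k)| :=
        Finset.abs_sum_le_sum_abs _ _
    _ ≤ ∑ k ∈ Finset.Ico r (n + 1 - r), M * (factorialPow d k * factorialPow d (n - k)) := by
        refine Finset.sum_le_sum fun k hk => ?_
        rw [Finset.mem_Ico] at hk
        rw [abs_mul, abs_mul, abs_of_pos (factorialPow_pos d k), mul_assoc]
        have := factorialPow_pos d k
        have := factorialPow_pos d (n - k)
        gcongr
        · exact hw k (by omega)
        · exact hg _
    _ ≤ _ := by
        rw [← Finset.mul_sum, mul_left_comm]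
        exact mul_le_mul_of_nonneg_left (sum_factorialPow_mul_le hd hn) hM

theorem sum_range_succ_eq_ends_add_middle (φ : ℕ → ℝ) {n r : ℕ} (hn : 2 * r ≤ n) :
    ∑ k ∈ Finset.range (n + 1), φ k = ∑ k ∈ Finset.range r, φ k +
      ∑ k ∈ Finset.Ico r (n + 1 - r), φ k + ∑ k ∈ Finset.range r, φ (n - k) := by
  have h := Finset.sum_Ico_reflect φ 0 (show r ≤ n + 1 by omega)
  rw [← Finset.range_eq_Ico, Nat.sub_zero] at h
  rw [h, Finset.range_eq_Ico, Finset.range_eq_Ico, add_assoc,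
    Finset.sum_Ico_consecutive _ (by omega) (by omega),
    Finset.sum_Ico_consecutive _ (by omega) (by omega)]

/-! ### Expansion of the inverse series -/

/-- Remainder of order `r` of the expansion of `g` along the shifts of `(n!) ^ d` with
coefficients `γ`. -/
noncomputable def expansionRemainder (d : ℕ) (g γ : ℕ → ℝ) (r n : ℕ) : ℝ :=
  g n - ∑ i ∈ Finset.range r, γ i * factorialPow d (n - i)

/-- Grouping terms by total shift m = k + i turns the coefficients into the Cauchy product of `u`
and `γ`; order r - k at index n - k keeps exactly the shifts below r. -/
theorem sum_mul_expansionRemainder (d : ℕ) (u g γ : ℕ → ℝ) (r n : ℕ) :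
    ∑ k ∈ Finset.range r, u k * expansionRemainder d g γ (r - k) (n - k) =
      ∑ k ∈ Finset.range r, u k * g (n - k) -
        ∑ m ∈ Finset.range r,
          (∑ k ∈ Finset.range (m + 1), u k * γ (m - k)) * factorialPow d (n - m) := by
  have h := Finset.sum_range_diag_flip r fun k i => u k * γ i * factorialPow d (n - k - i)
  have h2 : ∑ m ∈ Finset.range r,
      (∑ k ∈ Finset.range (m + 1), u k * γ (m - k)) * factorialPow d (n - m) =
      ∑ m ∈ Finset.range r, ∑ k ∈ Finset.range (m + 1),
        u k * γ (m - k) * factorialPow d (n - k - (m - k)) := by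
    refine Finset.sum_congr rfl fun m _ => ?_
    rw [Finset.sum_mul]
    refine Finset.sum_congr rfl fun k hk => ?_
    rw [Finset.mem_range] at hk
    rw [show n - k - (m - k) = n - m by omega]
  rw [h2, h, ← Finset.sum_sub_distrib]
  refine Finset.sum_congr rfl fun k _ => ?_
  rw [expansionRemainder, mul_sub, Finset.mul_sum]
  simp only [mul_assoc]

theorem expansionRemainder_shift {d : ℕ} {g γ : ℕ → ℝ} {r k : ℕ} (hk : k ≤ r)
    (h : expansionRemainder d g γ (r - k) =O[atTop] fun n => factorialPow d (n - (r - k))) :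
    (fun n => expansionRemainder d g γ (r - k) (n - k)) =O[atTop]
      fun n => factorialPow d (n - r) := by
  have := h.comp_tendsto (tendsto_sub_atTop_nat k)
  refine this.congr_right fun n => ?_
  simp only [Function.comp_apply]
  rw [show n - k - (r - k) = n - r by omega]

/-- If `g` is the inverse of `(n!) ^ d` for the Cauchy product, then `g` has an expansion along
the shifts of `(n!) ^ d`. -/
theorem expansionRemainder_isBigO {d : ℕ} (hd : 0 < d) {g γ : ℕ → ℝ}
    (hg : ∀ n, |g n| ≤ factorialPow d n)
    (hfg : ∀ n, n ≠ 0 → ∑ k ∈ Finset.range (n + 1), factorialPow d k * g (n - k) = 0)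
    (hγ : ∀ n, ∑ k ∈ Finset.range (n + 1), factorialPow d k * γ (n - k) = -g n) (r : ℕ) :
    expansionRemainder d g γ r =O[atTop] fun n => factorialPow d (n - r) := by
  induction r using Nat.strong_induction_on with
  | _ r ih =>
  rcases r with _ | s
  · refine IsBigO.of_bound 1 (Eventually.of_forall fun n => ?_)
    simpa [expansionRemainder, abs_of_pos (factorialPow_pos d n)] using hg n
  · have key : ∀ᶠ n in atTop, expansionRemainder d g γ (s + 1) n =
        -∑ k ∈ Finset.Ico (s + 1) (n + 1 - (s + 1)), 1 * factorialPow d k * g (n - k) -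
          ∑ k ∈ Finset.range s, factorialPow d (k + 1) *
            expansionRemainder d g γ (s + 1 - (k + 1)) (n - (k + 1)) := by
      filter_upwards [eventually_ge_atTop (2 * (s + 1))] with n hn
      have h1 := sum_mul_expansionRemainder d (factorialPow d) g γ (s + 1) n
      have h2 := sum_range_succ_eq_ends_add_middle
        (fun k => factorialPow d k * g (n - k)) (r := s + 1) hn
      rw [hfg n (by omega)] at h2
      -- The term k = 0 is the remainder under study; the others have lower order and fall under the
      -- induction hypothesis.
      rw [Finset.sum_range_succ'] at h1
      simp only [hγ, factorialPow_zero, Nat.sub_zero, one_mul] at h1 ⊢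
      have h3 : ∑ k ∈ Finset.range (s + 1), factorialPow d (n - k) * g (n - (n - k)) =
          -∑ m ∈ Finset.range (s + 1), -g m * factorialPow d (n - m) := by
        rw [← Finset.sum_neg_distrib]
        refine Finset.sum_congr rfl fun k hk => ?_
        rw [Finset.mem_range] at hk
        rw [show n - (n - k) = k by omega]
        ring
      linarith
    refine IsBigO.congr' ?_ (key.mono fun n hn => hn.symm) EventuallyEq.rfl
    refine IsBigO.sub (IsBigO.neg_left ?_) ?_
    · refine IsBigO.of_bound (((2 * (s + 1).factorial + (s + 1 + 1).factorial : ℕ) : ℝ) ^ d) ?_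
      filter_upwards [eventually_ge_atTop (2 * (s + 1) + 1)] with n hn
      have := norm_sum_mul_le hd hg (fun _ => 1) hn (M := 1) (by simp)
      rw [one_mul] at this
      rwa [Real.norm_eq_abs, Real.norm_eq_abs, abs_of_pos (factorialPow_pos d _)]
    · refine IsBigO.fun_sum fun k hk => IsBigO.const_mul_left ?_ _
      exact expansionRemainder_shift (by simp at hk; omega) (ih _ (by omega))

/-! ### Identities between power series, and the logarithm -/

open PowerSeries in
theorem coeff_X_mul_derivative (A : PowerSeries ℝ) (n : ℕ) :
    coeff n (X * derivative ℝ A) = n * coeff n A := by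
  cases n with
  | zero => simp
  | succ n =>
    rw [coeff_succ_X_mul, coeff_derivative]
    push_cast
    ring

open PowerSeries in
theorem coeff_mul_mk (A : PowerSeries ℝ) (v : ℕ → ℝ) (n : ℕ) :
    coeff n (A * mk v) = ∑ k ∈ Finset.range (n + 1), coeff k A * v (n - k) := by
  rw [coeff_mul, Finset.Nat.sum_antidiagonal_eq_sum_range_succ
    (fun i j => coeff i A * coeff j (mk v))]
  simp

open PowerSeries in
theorem mk_mul_mk_eq_one {f g : ℕ → ℝ} (h0 : f 0 * g 0 = 1)
    (hfg : ∀ n, n ≠ 0 → ∑ k ∈ Finset.range (n + 1), f k * g (n - k) = 0) :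
    mk f * mk g = 1 := by
  ext n
  rw [coeff_mul_mk, coeff_one]
  simp only [coeff_mk]
  split_ifs with h
  · subst h; simpa using h0
  · exact hfg n h

-- The coefficients are those of -G², where G = 1/F. The two identities read F · (-G²) = -G and z F'
-- · (-G²) = z G', the latter from differentiating F G = 1.
open PowerSeries in
theorem exists_expansion_coefficients {f g : ℕ → ℝ} (h : mk f * mk g = 1) :
    ∃ γ : ℕ → ℝ, (∀ n, ∑ k ∈ Finset.range (n + 1), f k * γ (n - k) = -g n) ∧
      ∀ n, ∑ k ∈ Finset.range (n + 1), k * f k * γ (n - k) = n * g n := by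
  set Γ : PowerSeries ℝ := -(mk g * mk g)
  have hΓ : mk (fun n => coeff n Γ) = Γ := by ext; simp
  refine ⟨fun n => coeff n Γ, fun n => ?_, fun n => ?_⟩
  · have h1 : mk f * Γ = -mk g := by linear_combination (-mk g) * h
    rw [← hΓ] at h1
    have h2 := congrArg (coeff n) h1
    rw [coeff_mul_mk] at h2
    simpa using h2
  · have h0 : derivative ℝ (mk f) * mk g + mk f * derivative ℝ (mk g) = 0 := by
      have := congrArg (derivative ℝ) h
      rw [Derivation.leibniz, derivative_one, smul_eq_mul, smul_eq_mul] at this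
      linear_combination this
    have h1 : X * derivative ℝ (mk f) * Γ = X * derivative ℝ (mk g) := by
      linear_combination (-X * mk g) * h0 + X * derivative ℝ (mk g) * h
    rw [← hΓ] at h1
    have h2 := congrArg (coeff n) h1
    rw [coeff_mul_mk, coeff_X_mul_derivative] at h2
    simpa only [coeff_X_mul_derivative, coeff_mk] using h2

-- The hypothesis is z F' = z C' · F, which defines C = log F up to a constant; multiply by G = 1/F.
open PowerSeries in
theorem mul_eq_sum_of_log {f g c : ℕ → ℝ} (h : mk f * mk g = 1)
    (hc : ∀ n : ℕ, n * f n = ∑ k ∈ Finset.range (n + 1), k * c k * f (n - k)) (n : ℕ) :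
    n * c n = ∑ k ∈ Finset.range (n + 1), k * f k * g (n - k) := by
  have h1 : X * derivative ℝ (mk c) * mk f = X * derivative ℝ (mk f) := by
    ext n
    rw [coeff_mul_mk]
    simp only [coeff_X_mul_derivative, coeff_mk]
    exact (hc n).symm
  have h2 : X * derivative ℝ (mk f) * mk g = X * derivative ℝ (mk c) := by
    linear_combination (-mk g) * h1 + X * derivative ℝ (mk c) * h
  have h3 := congrArg (coeff n) h2
  rw [coeff_mul_mk] at h3
  simp only [coeff_X_mul_derivative, coeff_mk] at h3
  exact h3.symm

/-- The logarithm of the series with coefficients `(n!) ^ d` has an expansion along the shifts of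
`(n!) ^ d`, with coefficients those of the inverse series. -/
theorem log_expansion {d : ℕ} (hd : 0 < d) {g c : ℕ → ℝ} (h0 : g 0 = 1)
    (hg : ∀ n, |g n| ≤ factorialPow d n)
    (hfg : ∀ n, n ≠ 0 → ∑ k ∈ Finset.range (n + 1), factorialPow d k * g (n - k) = 0)
    (hc : ∀ n : ℕ, n * factorialPow d n =
      ∑ k ∈ Finset.range (n + 1), k * c k * factorialPow d (n - k)) (r : ℕ) :
    expansionRemainder d c g r =O[atTop] fun n => factorialPow d (n - r) := by
  have hone := mk_mul_mk_eq_one (f := factorialPow d) (g := g) (by simp [h0]) hfg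
  obtain ⟨γ, hγ1, hγ2⟩ := exists_expansion_coefficients hone
  have hlog := mul_eq_sum_of_log hone hc
  have key : ∀ᶠ n : ℕ in atTop, n * expansionRemainder d c g r n =
      ∑ k ∈ Finset.Ico r (n + 1 - r), k * factorialPow d k * g (n - k) +
        ∑ k ∈ Finset.range r, k * factorialPow d k *
          expansionRemainder d g γ (r - k) (n - k) := by
    filter_upwards [eventually_ge_atTop (2 * r)] with n hn
    have h1 := sum_mul_expansionRemainder d (fun k => k * factorialPow d k) g γ r n
    have h2 := sum_range_succ_eq_ends_add_middle
      (fun k => k * factorialPow d k * g (n - k)) hn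
    simp only [hγ2] at h1
    -- Writing n - k as a difference, the n part is the desired main term, while the other part
    -- cancels the Cauchy product in `h1`.
    have h3 : ∑ k ∈ Finset.range r,
          ((n - k : ℕ) : ℝ) * factorialPow d (n - k) * g (n - (n - k)) =
        n * ∑ m ∈ Finset.range r, g m * factorialPow d (n - m) -
          ∑ m ∈ Finset.range r, m * g m * factorialPow d (n - m) := by
      rw [Finset.mul_sum, ← Finset.sum_sub_distrib]
      refine Finset.sum_congr rfl fun k hk => ?_
      rw [Finset.mem_range] at hk
      rw [show n - (n - k) = k by omega, Nat.cast_sub (by omega)]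
      ring
    rw [expansionRemainder, mul_sub, hlog n]
    linarith
  have hbig : (fun n : ℕ => n * expansionRemainder d c g r n) =O[atTop]
      fun n => n * factorialPow d (n - r) := by
    refine IsBigO.congr' ?_ (key.mono fun n hn => hn.symm) EventuallyEq.rfl
    refine IsBigO.add ?_ ?_
    · refine IsBigO.of_bound (((2 * r.factorial + (r + 1).factorial : ℕ) : ℝ) ^ d) ?_
      filter_upwards [eventually_ge_atTop (2 * r + 1)] with n hn
      have := norm_sum_mul_le hd hg (fun k => (k : ℝ)) hn (M := n)
        (fun k hk => by rw [Nat.abs_cast]; exact_mod_cast hk)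
      rwa [Real.norm_eq_abs, norm_mul, Real.norm_natCast, Real.norm_eq_abs,
        abs_of_pos (factorialPow_pos d _)]
    -- This end carries no factor n, so it is smaller than required.
    · refine IsBigO.trans (g := fun n => factorialPow d (n - r)) ?_ ?_
      · refine IsBigO.fun_sum fun k hk => IsBigO.const_mul_left ?_ _
        exact expansionRemainder_shift (Finset.mem_range.1 hk).le
          (expansionRemainder_isBigO hd hg hfg hγ1 _)
      · refine IsBigO.of_bound 1 ?_
        filter_upwards [eventually_ge_atTop 1] with n hn
        have hn' : (1 : ℝ) ≤ n := by exact_mod_cast hn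
        rw [norm_mul, one_mul, Real.norm_natCast]
        exact le_mul_of_one_le_left (norm_nonneg _) hn'
  have hinv := (isBigO_refl (fun n : ℕ => (n : ℝ)⁻¹) atTop).mul hbig
  refine hinv.congr' ?_ ?_ <;>
  · filter_upwards [eventually_ge_atTop 1] with n hn
    have : (n : ℝ) ≠ 0 := by positivity
    field_simp

/-! ### Generating functions of gluings and the conclusion -/

theorem sum_range_two_mul_succ_of_odd {M : Type*} [AddCommMonoid M] (φ : ℕ → M)
    (h : ∀ m, Odd m → φ m = 0) (n : ℕ) :
    ∑ m ∈ Finset.range (2 * n + 1), φ m = ∑ k ∈ Finset.range (n + 1), φ (2 * k) := by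
  induction n with
  | zero => simp
  | succ n ih =>
    rw [Finset.sum_range_succ _ (n + 1), ← ih, show 2 * (n + 1) + 1 = 2 * n + 1 + 1 + 1 by ring,
      Finset.sum_range_succ, Finset.sum_range_succ, h (2 * n + 1) ⟨n, rfl⟩, add_zero]
    rfl

theorem BipartiteGluing.count_two_mul_eq (d n : ℕ) :
    (count (d + 1) (2 * n) : ℝ) = (2 * n).factorial * factorialPow d n := by
  rw [count_two_mul, factorialPow]
  have h := Nat.choose_mul_factorial_mul_factorial (show n ≤ 2 * n by omega)
  rw [show 2 * n - n = n by omega] at h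
  rw [← h]
  push_cast
  ring

/-- Number of connected gluings on `2 n` vertices, divided by `(2 n)!`. -/
noncomputable def connWeight (D n : ℕ) : ℝ :=
  BipartiteGluing.connCount D (2 * n) / (2 * n).factorial

/-- This is z F' = z C' · F: the component recurrence on 2n vertices, stripped of its vanishing odd
terms and divided by 2 (2n)!. -/
theorem mul_factorialPow_eq_sum_connWeight (d n : ℕ) :
    n * factorialPow d n =
      ∑ k ∈ Finset.range (n + 1), k * connWeight (d + 1) k * factorialPow d (n - k) := by
  have h := BipartiteGluing.mul_count_eq (D := d + 1) (2 * n)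
  rw [sum_range_two_mul_succ_of_odd] at h
  · have h2 : ((2 * n * BipartiteGluing.count (d + 1) (2 * n) : ℕ) : ℝ) =
        2 * (2 * n).factorial * ∑ k ∈ Finset.range (n + 1),
          k * connWeight (d + 1) k * factorialPow d (n - k) := by
      rw [h, Nat.cast_sum, Finset.mul_sum]
      refine Finset.sum_congr rfl fun k hk => ?_
      rw [Finset.mem_range] at hk
      have h3 := Nat.choose_mul_factorial_mul_factorial (show 2 * k ≤ 2 * n by omega)
      push_cast
      rw [show 2 * n - 2 * k = 2 * (n - k) by omega] at h3 ⊢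
      rw [BipartiteGluing.count_two_mul_eq, connWeight, ← h3]
      push_cast
      field_simp
    push_cast at h2
    rw [BipartiteGluing.count_two_mul_eq] at h2
    have h4 : (0 : ℝ) < (2 * n).factorial := by positivity
    refine mul_left_cancel₀ (mul_pos two_pos h4).ne' ?_
    rw [← h2]
    ring
  · intro m hm
    by_cases hmn : m ≤ 2 * n
    · rw [BipartiteGluing.count_of_odd (Nat.Even.sub_odd hmn (even_two_mul n) hm)]
      simp
    · rw [Nat.choose_eq_zero_of_lt (by omega), zero_mul]

/-- Coefficients of the inverse of the series `∑ (n!) ^ d X ^ n`. -/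
noncomputable def inverseCoeff (d n : ℕ) : ℝ := if n = 0 then 1 else -(numIndecomposable d n : ℝ)

theorem abs_inverseCoeff_le (d n : ℕ) : |inverseCoeff d n| ≤ factorialPow d n := by
  rw [inverseCoeff]
  split_ifs with h
  · simp [h]
  · rw [abs_neg, Nat.abs_cast, factorialPow]
    exact_mod_cast numIndecomposable_le d n

theorem sum_factorialPow_mul_inverseCoeff (d n : ℕ) (hn : n ≠ 0) :
    ∑ k ∈ Finset.range (n + 1), factorialPow d k * inverseCoeff d (n - k) = 0 := by
  obtain ⟨m, rfl⟩ := Nat.exists_eq_succ_of_ne_zero hn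
  -- Reflection brings the term with `inverseCoeff d 0 = 1` to index 0, where it is split off; the
  -- rest is the first-block decomposition.
  rw [← Finset.sum_range_reflect, Finset.sum_range_succ']
  have h : factorialPow d (m + 1) =
      ∑ j ∈ Finset.range (m + 1), numIndecomposable d (j + 1) * factorialPow d (m - j) := by
    simp only [factorialPow]
    exact_mod_cast Multipermutation.factorial_pow_eq_sum d m
  have h1 : ∀ k ∈ Finset.range (m + 1),
      factorialPow d (m + 1 + 1 - 1 - (k + 1)) *
        inverseCoeff d (m + 1 - (m + 1 + 1 - 1 - (k + 1))) =
      -(numIndecomposable d (k + 1) * factorialPow d (m - k)) := by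
    intro k hk
    rw [Finset.mem_range] at hk
    rw [show m + 1 + 1 - 1 - (k + 1) = m - k by omega, show m + 1 - (m - k) = k + 1 by omega,
      inverseCoeff, if_neg (by omega)]
    ring
  rw [Nat.succ_eq_add_one, Finset.sum_congr rfl h1, Finset.sum_neg_distrib, ← h]
  simp [inverseCoeff]

theorem factorialPow_sub_div {n k : ℕ} (d : ℕ) (h : k ≤ n) :
    factorialPow d (n - k) / factorialPow d n = 1 / (n.descFactorial k : ℝ) ^ d := by
  have h1 : ((n - k).factorial : ℝ) * n.descFactorial k = n.factorial := by
    exact_mod_cast Nat.factorial_mul_descFactorial h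
  have h2 : (n.descFactorial k : ℝ) ≠ 0 := by
    exact_mod_cast (Nat.pos_of_ne_zero (by rw [Ne, Nat.descFactorial_eq_zero_iff_lt]; omega)).ne'
  rw [factorialPow, factorialPow, ← h1, mul_pow]
  have h3 : ((n - k).factorial : ℝ) ≠ 0 := by positivity
  field_simp

theorem probConnectedOrientableGEM_two_mul (d n : ℕ) (hn : n ≠ 0) :
    probConnectedOrientableGEM (d + 1) (2 * n) = connWeight (d + 1) n / factorialPow d n := by
  have : NeZero (2 * n) := ⟨by omega⟩
  rw [probConnectedOrientableGEM_eq, BipartiteGluing.count_two_mul_eq, connWeight, div_div]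

theorem inverseCoeff_div_descFactorial (d k n : ℕ) :
    (if k = 0 then (1 : ℝ) else
        -((numIndecomposable d k : ℝ) / ((n.descFactorial k : ℝ) ^ d))) =
      inverseCoeff d k / (n.descFactorial k : ℝ) ^ d := by
  rw [inverseCoeff]
  split_ifs with h
  · simp [h]
  · rw [neg_div]

theorem inverseCoeff_ne_zero {d : ℕ} (hd : 0 < d) (k : ℕ) : inverseCoeff d k ≠ 0 := by
  rw [inverseCoeff]
  split_ifs
  · exact one_ne_zero
  · exact neg_ne_zero.2 (by exact_mod_cast (numIndecomposable_pos hd k).ne')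

/-- The ratio of consecutive terms is (n - k)^(-d), which tends to 0 because d > 0. -/
theorem one_div_descFactorial_pow_succ_isLittleO {d : ℕ} (hd : 0 < d) (k : ℕ) :
    (fun n : ℕ => 1 / (n.descFactorial (k + 1) : ℝ) ^ d) =o[atTop]
      fun n : ℕ => 1 / (n.descFactorial k : ℝ) ^ d := by
  have h1 : Tendsto (fun n : ℕ => (((n - k : ℕ) : ℝ) ^ d)⁻¹) atTop (nhds 0) :=
    tendsto_inv_atTop_zero.comp ((tendsto_pow_atTop hd.ne').comp
      (tendsto_natCast_atTop_atTop.comp (tendsto_sub_atTop_nat k)))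
  have h2 := ((isLittleO_one_iff ℝ).2 h1).mul_isBigO
    (isBigO_refl (fun n : ℕ => 1 / (n.descFactorial k : ℝ) ^ d) atTop)
  refine h2.congr (fun n => ?_) fun n => one_mul _
  rw [Nat.descFactorial_succ, Nat.cast_mul, mul_pow, one_div, one_div, mul_inv]

theorem mainTheorem10 (D : ℕ) (hD : 2 ≤ D) :
    HasAsymptoticExpansion
      (fun n => probConnectedOrientableGEM D (2 * n)) 0
      (fun k n => if k = 0 then (1 : ℝ) else
        -((numIndecomposable (D - 1) k : ℝ) / ((n.descFactorial k : ℝ) ^ (D - 1)))) := by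
  obtain ⟨d, rfl⟩ := Nat.exists_eq_add_of_le' (show 1 ≤ D by omega)
  have hd : 0 < d := by omega
  rw [Nat.add_sub_cancel]
  simp only [inverseCoeff_div_descFactorial]
  have hrw (k n : ℕ) : inverseCoeff d k / (n.descFactorial k : ℝ) ^ d =
      inverseCoeff d k * (1 / (n.descFactorial k : ℝ) ^ d) := by rw [mul_one_div]
  refine ⟨fun r _ => ?_, fun k _ => ?_⟩
  · have h := log_expansion hd (g := inverseCoeff d) (c := connWeight (d + 1))
      (by simp [inverseCoeff]) (abs_inverseCoeff_le d) (sum_factorialPow_mul_inverseCoeff d)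
      (mul_factorialPow_eq_sum_connWeight d) (r + 1)
    -- Divide by f_n, then absorb the nonzero constant `inverseCoeff d (r + 1)` into the O.
    have h2 := (h.mul (isBigO_refl (fun n => (factorialPow d n)⁻¹) atTop)).trans
      (isBigO_self_const_mul (inverseCoeff_ne_zero hd (r + 1)) _ atTop)
    refine h2.congr' ?_ ?_
    · filter_upwards [eventually_ge_atTop (r + 1)] with n hn
      rw [probConnectedOrientableGEM_two_mul d n (by omega), expansionRemainder,
        ← div_eq_mul_inv, sub_div, Finset.sum_div, Finset.range_eq_Ico]
      congr 1
      refine Finset.sum_congr rfl fun k hk => ?_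
      rw [Finset.mem_Icc] at hk
      rw [mul_div_assoc, factorialPow_sub_div d (by omega), mul_one_div]
    · filter_upwards [eventually_ge_atTop (r + 1)] with n hn
      rw [← div_eq_mul_inv, factorialPow_sub_div d hn, hrw]
  · simp only [hrw]
    exact ((one_div_descFactorial_pow_succ_isLittleO hd k).const_mul_left _).trans_isBigO
      (isBigO_self_const_mul (inverseCoeff_ne_zero hd k) _ atTop)
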